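/- For a finite simple graph $G$, let $\chi_\ell(G)$ denote its list chromatic number, i.e. the least $k$ such that for every assignment of sets $L(v)\subseteq\mathbb{N}$ with $|L(v)|\ge k$ to the vertices $v$ of $G$ there is a proper colouring $c$ of $G$ with $c(v)\in L(v)$ for every vertex $v$. Then for every $\varepsilon>0$ there exists $f_0=f_0(\varepsilon)$ such that the following holds for every real $f\ge f_0$. Let $G$ be a finite simple graph of maximum degree $\Delta$, where $1\le f\le \Delta^2+1$, such that for every vertex $v$ the subgraph of $G$ induced by the neighbourhood $N(v)$ has at most $\Delta^2/f$ edges. Then \[ \chi_\ell(G)\;\le\;(1+\varepsilon)\,\frac{\Delta}{\ln\min\{\Delta,f\}} . \] (In other words, $\chi_\ell(G)\le(1+o(1))\,\Delta/\ln\min\{\Delta,f\}$ as $f\to\infty$, where the $o(1)$ term depends only on $f$.) -/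

import Mathlib

namespace SimpleGraph

/-- `G` is `L`-colourable: there is a proper colouring `c` of `G` with `c v ∈ L v` for all `v`. -/
def IsListColorable {V : Type*} (G : SimpleGraph V) (L : V → Set ℕ) : Prop :=
  ∃ c : V → ℕ, (∀ v, c v ∈ L v) ∧ ∀ u v, G.Adj u v → c u ≠ c v

/-- `G` is `L`-colourable for every list-assignment `L` whose lists (finite or infinite)
all have at least `k` elements. -/
def IsChoosable {V : Type*} (G : SimpleGraph V) (k : ℕ) : Prop :=
  ∀ L : V → Set ℕ, (∀ v, (k : ℕ∞) ≤ (L v).encard) → G.IsListColorable L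

/-- The list chromatic number: the least `k` such that `G` is `L`-colourable for every
list-assignment `L` with lists of size at least `k` (and `⊤` if there is no such `k`). -/
noncomputable def listChromaticNumber {V : Type*} (G : SimpleGraph V) : ℕ∞ :=
  ⨅ (k : ℕ) (_ : G.IsChoosable k), (k : ℕ∞)

end SimpleGraph

/-!
Colourings are counted one vertex at a time. Adding a vertex `v` to a set `S` multiplies the number
of list colourings by the average number of colours that a uniformly random colouring of `S` leaves
available at `v`, and by induction each such factor is at least some `l`, which is much larger than
`t = o(l)`.

The induction hypothesis shows that typically almost all neighbours of `v` have more than `t`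
colours left over by the non-neighbours of `v`; the bound on the edges in `N(v)` shows that almost
all of them have at most `d = o(t)` neighbours in `N(v)`. Reveal all colours except those of these
good neighbours. What remains random is a colouring of a graph of maximum degree `d` from lists
`L u` of more than `t - d` colours, in which a colour `x` is avoided with probability about
`exp (-∑ 1 / |L u|)`, the sum running over the `u` with `x ∈ L u`. Averaging over the `n` colours
still possible for `v` and using Jensen's inequality, about `n * exp (-Δ / n)` of them survive,
which is at least `2 * l` when `n` exceeds `Δ / log (min Δ f)` by a constant factor.
-/

open Finset Function

namespace ListColoring

section Colorings

variable {V α : Type*} [DecidableEq α] {G : SimpleGraph V} [DecidableRel G.Adj]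
  {L : V → Finset α}

variable (G L) in
/-- The colours of the list `L v` that the colouring `c` does not use on the neighbours of `v`
in `S`. -/
def availableColors (S : Finset V) (c : V → α) (v : V) : Finset α :=
  {x ∈ L v | ∀ u ∈ S, G.Adj v u → c u ≠ x}

theorem mem_availableColors {S : Finset V} {c : V → α} {v : V} {x : α} :
    x ∈ availableColors G L S c v ↔ x ∈ L v ∧ ∀ u ∈ S, G.Adj v u → c u ≠ x := by
  simp [availableColors]

theorem availableColors_congr {S : Finset V} {c c' : V → α} (h : ∀ u ∈ S, c u = c' u) (v : V) :
    availableColors G L S c v = availableColors G L S c' v := by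
  ext x
  simp only [mem_availableColors]
  exact and_congr_right fun _ => forall₂_congr fun u hu => by rw [h u hu]

theorem availableColors_anti {S T : Finset V} (h : S ⊆ T) (c : V → α) (v : V) :
    availableColors G L T c v ⊆ availableColors G L S c v := by
  intro x hx
  rw [mem_availableColors] at hx ⊢
  exact ⟨hx.1, fun u hu => hx.2 u (h hu)⟩

theorem card_availableColors_le_add [DecidableEq V] (S T : Finset V) (c : V → α) (v : V) :
    #(availableColors G L S c v) ≤ #(availableColors G L T c v) + #{u ∈ T \ S | G.Adj v u} := by
  have h : availableColors G L S c v ⊆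
      availableColors G L T c v ∪ ({u ∈ T \ S | G.Adj v u} : Finset V).image c := by
    intro x hx
    simp only [mem_availableColors, mem_union, mem_image, mem_filter, mem_sdiff] at hx ⊢
    grind
  calc _ ≤ _ := card_le_card h
    _ ≤ _ := card_union_le _ _
    _ ≤ _ := Nat.add_le_add_left card_image_le _

theorem card_le_card_availableColors_add (S : Finset V) (c : V → α) (v : V) :
    #(L v) ≤ #(availableColors G L S c v) + #{u ∈ S | G.Adj v u} := by
  classical simpa [availableColors] using card_availableColors_le_add (G := G) (L := L) ∅ S c v

variable [DecidableEq V]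

theorem availableColors_update {S : Finset V} {u : V} (hu : u ∉ S) (c : V → α) (x : α) (v : V) :
    availableColors G L S (update c u x) v = availableColors G L S c v :=
  availableColors_congr (fun _ hw => update_of_ne (ne_of_mem_of_not_mem hw hu) _ _) v

theorem availableColors_availableColors {S T : Finset V} {c c' : V → α}
    (h : ∀ u ∈ S, c' u = c u) (v : V) :
    availableColors G (availableColors G L S c) T c' v = availableColors G L (S ∪ T) c' v := by
  rw [availableColors, ← availableColors_congr h]
  ext x
  simp only [mem_filter, mem_availableColors, mem_union, or_imp, forall_and, and_assoc]

variable [Fintype V] {S T : Finset V} {b : V → α}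

variable (G L) in
/-- The proper `L`-colourings of the subgraph of `G` induced by `S`. They are encoded as functions
on all of `V` that agree with a fixed background `b` outside `S`; adjacencies with vertices
outside `S` are ignored. -/
def coloringsOn (S : Finset V) (b : V → α) : Finset (V → α) :=
  {c ∈ Fintype.piFinset (S.piecewise L fun u => {b u}) |
    ∀ u ∈ S, ∀ w ∈ S, G.Adj u w → c u ≠ c w}

theorem mem_coloringsOn {c : V → α} :
    c ∈ coloringsOn G L S b ↔ (∀ u ∈ S, c u ∈ L u) ∧ (∀ u ∉ S, c u = b u) ∧
      ∀ u ∈ S, ∀ w ∈ S, G.Adj u w → c u ≠ c w := by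
  have h : (∀ u, c u ∈ S.piecewise L (fun u => {b u}) u) ↔
      (∀ u ∈ S, c u ∈ L u) ∧ ∀ u ∉ S, c u = b u := by
    simp only [← forall_and, piecewise]
    refine forall_congr' fun u => ?_
    by_cases hu : u ∈ S <;> simp [hu]
  rw [coloringsOn, mem_filter, Fintype.mem_piFinset, h, and_assoc]

theorem coloringsOn_empty : coloringsOn G L ∅ b = {b} := by
  ext c
  simp [mem_coloringsOn, funext_iff]

theorem mem_coloringsOn_insert {v : V} (hv : v ∉ S) {c : V → α} :
    c ∈ coloringsOn G L (insert v S) b ↔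
      update c v (b v) ∈ coloringsOn G L S b ∧ c v ∈ availableColors G L S c v := by
  have hirr := G.irrefl (v := v)
  have hsymm := G.adj_comm v
  simp only [mem_coloringsOn, mem_availableColors, mem_insert, update_apply]
  grind

theorem sum_coloringsOn_insert {M : Type*} [AddCommMonoid M] {v : V} (hv : v ∉ S)
    (f : (V → α) → M) :
    ∑ c ∈ coloringsOn G L (insert v S) b, f c =
      ∑ c ∈ coloringsOn G L S b, ∑ x ∈ availableColors G L S c v, f (update c v x) := by
  rw [sum_sigma']
  refine sum_nbij' (fun c => ⟨update c v (b v), c v⟩) (fun p => update p.1 v p.2) ?_ ?_ ?_ ?_ ?_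
  · intro c hc
    rwa [mem_sigma, availableColors_update hv, ← mem_coloringsOn_insert hv]
  · rintro ⟨c, x⟩ h
    obtain ⟨hc, hx⟩ := mem_sigma.1 h
    have hcv : b v = c v := ((mem_coloringsOn.1 hc).2.1 v hv).symm
    rw [mem_coloringsOn_insert hv, availableColors_update hv, update_idem, hcv, update_eq_self,
      update_self]
    exact ⟨hc, hx⟩
  · simp
  · rintro ⟨c, x⟩ h
    have hcv : b v = c v := ((mem_coloringsOn.1 (mem_sigma.1 h).1).2.1 v hv).symm
    simp [hcv]
  · simp

theorem card_filter_coloringsOn_insert {v : V} (hv : v ∉ S) {P : (V → α) → Prop}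
    [DecidablePred P] (hP : ∀ c x, P (update c v x) ↔ P c) :
    #{c ∈ coloringsOn G L (insert v S) b | P c} =
      ∑ c ∈ coloringsOn G L S b with P c, #(availableColors G L S c v) := by
  simp only [card_filter, sum_coloringsOn_insert hv, hP, sum_const, smul_eq_mul, mul_ite, mul_one,
    mul_zero, sum_filter]

theorem card_coloringsOn_insert {v : V} (hv : v ∉ S) :
    #(coloringsOn G L (insert v S) b) =
      ∑ c ∈ coloringsOn G L S b, #(availableColors G L S c v) := by
  simpa using card_filter_coloringsOn_insert (b := b) (L := L) (G := G) hv (P := fun _ => True)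
    fun _ _ => Iff.rfl

/-- A colouring of `S` with at most `t` colours available at `u` has at most `t` extensions
to `u`. -/
theorem card_filter_card_availableColors_le {u : V} (hu : u ∉ S) {t : ℝ} (ht : 0 ≤ t) :
    (#{c ∈ coloringsOn G L (insert u S) b | (#(availableColors G L S c u) : ℝ) ≤ t} : ℝ) ≤
      t * #(coloringsOn G L S b) := by
  rw [card_filter_coloringsOn_insert hu fun c x => by rw [availableColors_update hu], Nat.cast_sum]
  calc _ ≤ ∑ c ∈ coloringsOn G L S b with (#(availableColors G L S c u) : ℝ) ≤ t, t :=
        sum_le_sum fun c hc => (mem_filter.1 hc).2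
    _ ≤ ∑ _c ∈ coloringsOn G L S b, t :=
        sum_le_sum_of_subset_of_nonneg (filter_subset _ _) fun _ _ _ => ht
    _ = t * #(coloringsOn G L S b) := by rw [sum_const, nsmul_eq_mul, mul_comm]

theorem filter_coloringsOn_eq_coloringsOn_sdiff (hTS : T ⊆ S) {c₀ : V → α}
    (hc₀ : c₀ ∈ coloringsOn G L S b) :
    {c ∈ coloringsOn G L S b | ∀ u ∈ T, c u = c₀ u} =
      coloringsOn G (availableColors G L T c₀) (S \ T) c₀ := by
  have hsymm := G.adj_comm
  ext c
  simp only [mem_coloringsOn, mem_availableColors, mem_filter, mem_sdiff] at hc₀ ⊢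
  refine ⟨by grind, fun h => ⟨⟨by grind, by grind, fun u hu w hw huw => ?_⟩, by grind⟩⟩
  by_cases huT : u ∈ T <;> by_cases hwT : w ∈ T <;> grind

end Colorings

section Averaging

theorem card_mul_exp_sum_div_card_le_sum_exp {ι : Type*} (X : Finset ι) (a : ι → ℝ) :
    #X * Real.exp ((∑ x ∈ X, a x) / #X) ≤ ∑ x ∈ X, Real.exp (a x) := by
  rcases X.eq_empty_or_nonempty with rfl | hX
  · simp
  have hcard : (0 : ℝ) < #X := by exact_mod_cast hX.card_pos
  have hjensen := convexOn_exp.map_sum_le (t := X) (w := fun _ => (#X : ℝ)⁻¹) (p := a)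
    (fun _ _ => by positivity) (by simp [hcard.ne']) fun _ _ => Set.mem_univ _
  simp only [smul_eq_mul, ← div_eq_inv_mul, ← sum_div] at hjensen
  rwa [le_div_iff₀' hcard] at hjensen

theorem sum_sum_filter_mem_div_card_le {V α : Type*} [DecidableEq α] (X : Finset α)
    (A : Finset V) (L : V → Finset α) {β : ℝ} (hβ : 0 ≤ β) :
    ∑ x ∈ X, ∑ u ∈ A with x ∈ L u, β / #(L u) ≤ β * #A := by
  calc _ = ∑ u ∈ A, ∑ x ∈ X with x ∈ L u, β / #(L u) := by
        simp only [sum_filter]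
        exact sum_comm
    _ ≤ ∑ _u ∈ A, β := sum_le_sum fun u _ => by
        have hcard : (#{x ∈ X | x ∈ L u} : ℝ) ≤ #(L u) :=
          Nat.cast_le.2 (card_le_card fun x hx => (mem_filter.1 hx).2)
        rw [sum_const, nsmul_eq_mul, mul_div_left_comm]
        exact mul_le_of_le_one_right hβ (div_le_one_of_le₀ hcard (by positivity))
    _ = β * #A := by rw [sum_const, nsmul_eq_mul, mul_comm]

theorem add_one_lt_of_mul_add_one_le {d β n : ℝ} (hβ : 1 < β) (hd : 0 ≤ d)
    (hn : β * (d + 1) ≤ (β - 1) * n) : d + 1 < n := by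
  nlinarith

theorem exp_neg_div_le_one_sub {d β n : ℝ} (hβ : 1 < β) (hd : 0 ≤ d)
    (hn : β * (d + 1) ≤ (β - 1) * n) : Real.exp (-(β / n)) ≤ 1 - 1 / (n - d) := by
  have hdn := add_one_lt_of_mul_add_one_le hβ hd hn
  have hpos : 0 < 1 - 1 / (n - d) := by
    rw [sub_pos, div_lt_one (by linarith)]
    linarith
  have hinv : 1 - (1 - 1 / (n - d))⁻¹ = -(1 / (n - d - 1)) := by
    have : n - d ≠ 0 := by linarith
    have : n - d - 1 ≠ 0 := by linarith
    field_simp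
    ring
  rw [← Real.le_log_iff_exp_le hpos]
  calc -(β / n) ≤ -(1 / (n - d - 1)) := by
        rw [neg_le_neg_iff, div_le_div_iff₀ (by linarith) (by linarith)]
        linarith
    _ = 1 - (1 - 1 / (n - d))⁻¹ := hinv.symm
    _ ≤ Real.log (1 - 1 / (n - d)) := Real.one_sub_inv_le_log_of_pos hpos

variable {V α : Type*} [Fintype V] [DecidableEq V] [DecidableEq α] {G : SimpleGraph V}
  [DecidableRel G.Adj] {L : V → Finset α} {A : Finset V} {b : V → α} {d β : ℝ}

theorem mul_card_filter_apply_eq_le {u : V} (hu : u ∉ A)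
    (hdeg : (#{w ∈ A | G.Adj u w} : ℝ) ≤ d) (hL : d ≤ #(L u)) {P : (V → α) → Prop}
    [DecidablePred P] (hP : ∀ c x, P (update c u x) ↔ P c) (x : α) :
    (#(L u) - d) * #{c ∈ coloringsOn G L (insert u A) b | P c ∧ c u = x} ≤
      #{c ∈ coloringsOn G L (insert u A) b | P c} := by
  have hle : #{c ∈ coloringsOn G L (insert u A) b | P c ∧ c u = x} ≤
      #{c ∈ coloringsOn G L A b | P c} := by
    simp only [card_filter, sum_coloringsOn_insert hu, hP, update_self]
    refine sum_le_sum fun c _ => ?_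
    by_cases hc : P c <;> simp only [hc, true_and, false_and, if_true, if_false, sum_const_zero,
      sum_ite_eq', le_refl]
    split_ifs <;> simp
  have : 0 ≤ #(L u) - d := sub_nonneg.2 hL
  calc _ ≤ (#(L u) - d) * (#{c ∈ coloringsOn G L A b | P c} : ℝ) := by
        gcongr
    _ = ∑ c ∈ coloringsOn G L A b with P c, ((#(L u) : ℝ) - d) := by
        rw [sum_const, nsmul_eq_mul, mul_comm]
    _ ≤ ∑ c ∈ coloringsOn G L A b with P c, (#(availableColors G L A c u) : ℝ) :=
        sum_le_sum fun c _ => by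
          have : (#(L u) : ℝ) ≤ #(availableColors G L A c u) + #{w ∈ A | G.Adj u w} := by
            exact_mod_cast card_le_card_availableColors_add A c u
          linarith
    _ = _ := by rw [card_filter_coloringsOn_insert hu hP, Nat.cast_sum]

theorem mul_card_filter_le_card_filter_and_ne {u : V} (hu : u ∈ A)
    (hdeg : (#{w ∈ A | G.Adj u w} : ℝ) ≤ d) (hL : d + 1 ≤ #(L u)) {P : (V → α) → Prop}
    [DecidablePred P] (hP : ∀ c x, P (update c u x) ↔ P c) (x : α) :
    (1 - 1 / (#(L u) - d)) * #{c ∈ coloringsOn G L A b | P c} ≤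
      #{c ∈ coloringsOn G L A b | P c ∧ c u ≠ x} := by
  have hcond : (#{c ∈ coloringsOn G L A b | P c ∧ c u = x} : ℝ) ≤
      #{c ∈ coloringsOn G L A b | P c} / (#(L u) - d) := by
    have hdegErase : (#{w ∈ A.erase u | G.Adj u w} : ℝ) ≤ d :=
      (Nat.cast_le.2 (card_le_card (filter_subset_filter _ (erase_subset _ _)))).trans hdeg
    have h := mul_card_filter_apply_eq_le (L := L) (b := b) (notMem_erase u A) hdegErase
      (by linarith) hP x
    rwa [insert_erase hu, ← le_div_iff₀' (by linarith)] at h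
  have hsplit : (#{c ∈ coloringsOn G L A b | P c} : ℝ) =
      #{c ∈ coloringsOn G L A b | P c ∧ c u = x} +
        #{c ∈ coloringsOn G L A b | P c ∧ c u ≠ x} := by
    simp only [← filter_filter]
    exact_mod_cast (card_filter_add_card_filter_not _).symm
  rw [sub_mul, one_mul, one_div_mul_eq_div]
  linarith

/-- Each vertex `u` of `D` receives the colour `x` with conditional probability at most
`1 / (#(L u) - d)`, given that its predecessors avoid `x`. -/
theorem prod_mul_card_coloringsOn_le_card_filter
    (hdeg : ∀ u ∈ A, (#{w ∈ A | G.Adj u w} : ℝ) ≤ d) (hL : ∀ u ∈ A, d + 1 ≤ #(L u)) (x : α)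
    {D : Finset V} (hD : D ⊆ A) :
    (∏ u ∈ D with x ∈ L u, (1 - 1 / (#(L u) - d))) * #(coloringsOn G L A b) ≤
      #{c ∈ coloringsOn G L A b | ∀ w ∈ D, c w ≠ x} := by
  induction D using Finset.induction_on with
  | empty => simp
  | insert u D huD ih =>
    have huA : u ∈ A := hD (mem_insert_self _ _)
    specialize ih ((subset_insert _ _).trans hD)
    simp only [forall_mem_insert, and_comm (a := _ ≠ x), filter_insert]
    split_ifs with hx
    · have hfactor : 0 ≤ 1 - 1 / (#(L u) - d) := by
        rw [sub_nonneg, div_le_one (by linarith [hL u huA])]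
        linarith [hL u huA]
      rw [prod_insert (by simp [huD]), mul_assoc]
      exact (mul_le_mul_of_nonneg_left ih hfactor).trans <|
        mul_card_filter_le_card_filter_and_ne huA (hdeg u huA) (hL u huA)
          (fun c y => forall₂_congr fun w hw => by
            rw [update_of_ne (ne_of_mem_of_not_mem hw huD)]) x
    · refine ih.trans (Nat.cast_le.2 (card_le_card (monotone_filter_right _ fun c hc h => ⟨h, ?_⟩)))
      rintro rfl
      exact hx ((mem_coloringsOn.1 hc).1 u huA)

theorem exp_neg_sum_mul_card_coloringsOn_le_card_filter (hβ : 1 < β) (hd : 0 ≤ d)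
    (hdeg : ∀ u ∈ A, (#{w ∈ A | G.Adj u w} : ℝ) ≤ d)
    (hL : ∀ u ∈ A, β * (d + 1) ≤ (β - 1) * #(L u)) (x : α) :
    Real.exp (-∑ u ∈ A with x ∈ L u, β / #(L u)) * #(coloringsOn G L A b) ≤
      #{c ∈ coloringsOn G L A b | ∀ w ∈ A, c w ≠ x} := by
  refine le_trans ?_ (prod_mul_card_coloringsOn_le_card_filter hdeg
    (fun u hu => (add_one_lt_of_mul_add_one_le hβ hd (hL u hu)).le) x Subset.rfl)
  rw [← sum_neg_distrib, Real.exp_sum]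
  gcongr with u hu
  exact exp_neg_div_le_one_sub hβ hd (hL u (mem_filter.1 hu).1)

theorem card_mul_exp_mul_card_coloringsOn_le_sum_card_availableColors (hβ : 1 < β) (hd : 0 ≤ d)
    (hdeg : ∀ u ∈ A, (#{w ∈ A | G.Adj u w} : ℝ) ≤ d)
    (hL : ∀ u ∈ A, β * (d + 1) ≤ (β - 1) * #(L u)) (v : V) :
    #(L v) * Real.exp (-(β * #A / #(L v))) * #(coloringsOn G L A b) ≤
      ∑ c ∈ coloringsOn G L A b, (#(availableColors G L A c v) : ℝ) := by
  set a : α → ℝ := fun x => ∑ u ∈ A with x ∈ L u, β / #(L u)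
  have hsum : ∑ x ∈ L v, a x ≤ β * #A :=
    sum_sum_filter_mem_div_card_le (L v) A L (by linarith)
  have hcount : ∑ x ∈ L v, #{c ∈ coloringsOn G L A b | ∀ w ∈ A, c w ≠ x} ≤
      ∑ c ∈ coloringsOn G L A b, #(availableColors G L A c v) := by
    simp only [card_filter]
    rw [sum_comm]
    refine sum_le_sum fun c _ => ?_
    rw [← card_filter]
    refine card_le_card fun x hx => ?_
    rw [mem_filter] at hx
    exact mem_availableColors.2 ⟨hx.1, fun u hu _ => hx.2 u hu⟩
  calc _ ≤ #(L v) * Real.exp ((∑ x ∈ L v, -a x) / #(L v)) * #(coloringsOn G L A b) := by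
        rw [sum_neg_distrib, ← neg_div]
        gcongr
    _ ≤ (∑ x ∈ L v, Real.exp (-a x)) * #(coloringsOn G L A b) := by
        gcongr
        exact card_mul_exp_sum_div_card_le_sum_exp _ _
    _ = ∑ x ∈ L v, Real.exp (-a x) * #(coloringsOn G L A b) := sum_mul ..
    _ ≤ ∑ x ∈ L v, (#{c ∈ coloringsOn G L A b | ∀ w ∈ A, c w ≠ x} : ℝ) :=
        sum_le_sum fun x _ => exp_neg_sum_mul_card_coloringsOn_le_card_filter hβ hd hdeg hL x
    _ ≤ _ := by exact_mod_cast hcount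

theorem card_mul_exp_mul_card_extensions_le_sum_card_availableColors {S T : Finset V}
    (hTS : T ⊆ S) {c₀ : V → α} (hc₀ : c₀ ∈ coloringsOn G L S b) (hβ : 1 < β) (hd : 0 ≤ d)
    (hdeg : ∀ u ∈ S \ T, (#{w ∈ S \ T | G.Adj u w} : ℝ) ≤ d)
    (hL : ∀ u ∈ S \ T, β * (d + 1) ≤ (β - 1) * #(availableColors G L T c₀ u)) (v : V) :
    #(availableColors G L T c₀ v) *
        Real.exp (-(β * #(S \ T) / #(availableColors G L T c₀ v))) *
        #{c ∈ coloringsOn G L S b | ∀ u ∈ T, c u = c₀ u} ≤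
      ∑ c ∈ coloringsOn G L S b with ∀ u ∈ T, c u = c₀ u,
        (#(availableColors G L S c v) : ℝ) := by
  have havail : ∀ c ∈ coloringsOn G (availableColors G L T c₀) (S \ T) c₀,
      availableColors G (availableColors G L T c₀) (S \ T) c v = availableColors G L S c v := by
    intro c hc
    rw [← filter_coloringsOn_eq_coloringsOn_sdiff hTS hc₀] at hc
    rw [availableColors_availableColors (mem_filter.1 hc).2, union_sdiff_of_subset hTS]
  rw [filter_coloringsOn_eq_coloringsOn_sdiff hTS hc₀,
    ← sum_congr rfl fun c hc => congrArg (fun s => (#s : ℝ)) (havail c hc)]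
  exact card_mul_exp_mul_card_coloringsOn_le_sum_card_availableColors hβ hd hdeg hL v

end Averaging

section Extension

theorem card_le_two_mul_card_filter_of_sum_le {ι : Type*} {s : Finset ι} {f : ι → ℝ} {b : ℝ}
    (hf : ∀ i ∈ s, 0 ≤ f i) (hb : 0 < b) (h : ∑ i ∈ s, f i ≤ b / 2 * #s) :
    (#s : ℝ) ≤ 2 * #{i ∈ s | f i ≤ b} := by
  have hmarkov : b * #{i ∈ s | ¬ f i ≤ b} ≤ b * (#s / 2) := by
    calc b * #{i ∈ s | ¬ f i ≤ b} = ∑ i ∈ s with ¬ f i ≤ b, b := by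
          rw [sum_const, nsmul_eq_mul, mul_comm]
      _ ≤ ∑ i ∈ s with ¬ f i ≤ b, f i :=
          sum_le_sum fun i hi => (not_le.1 (mem_filter.1 hi).2).le
      _ ≤ ∑ i ∈ s, f i :=
          sum_le_sum_of_subset_of_nonneg (filter_subset _ _) fun i hi _ => hf i hi
      _ ≤ b * (#s / 2) := by linarith
  have hsplit : (#{i ∈ s | f i ≤ b} : ℝ) + #{i ∈ s | ¬ f i ≤ b} = #s := by
    exact_mod_cast card_filter_add_card_filter_not (s := s) (f · ≤ b)
  linarith [le_of_mul_le_mul_left hmarkov hb]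

theorem sum_le_sum_of_forall_fiber {ι κ : Type*} [DecidableEq κ] {s : Finset ι} (r : ι → κ)
    {f g : ι → ℝ} (h : ∀ i ∈ s, ∑ j ∈ s with r j = r i, f j ≤ ∑ j ∈ s with r j = r i, g j) :
    ∑ i ∈ s, f i ≤ ∑ i ∈ s, g i := by
  have hmaps : ∀ i ∈ s, r i ∈ s.image r := fun i hi => mem_image_of_mem r hi
  rw [← sum_fiberwise_of_maps_to hmaps, ← sum_fiberwise_of_maps_to hmaps]
  exact sum_le_sum (forall_mem_image.2 h)

variable {V : Type*} [Fintype V] [DecidableEq V] {G : SimpleGraph V} [DecidableRel G.Adj]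

theorem sum_card_neighborFinset_inter (v : V) :
    ∑ u ∈ G.neighborFinset v, #(G.neighborFinset v ∩ G.neighborFinset u) =
      2 * (G.induce (G.neighborSet v)).edgeSet.ncard := by
  rw [← SimpleGraph.coe_edgeFinset, Set.ncard_coe_finset,
    ← SimpleGraph.sum_degrees_eq_twice_card_edges,
    sum_subtype (G.neighborFinset v) (p := (· ∈ G.neighborSet v)) (by simp)]
  refine Fintype.sum_congr _ _ fun u => ?_
  rw [← SimpleGraph.card_neighborFinset_eq_degree, ← card_map (Embedding.subtype _)]
  congr 1
  ext w
  simp [and_comm]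

theorem mul_card_filter_lt_card_neighborFinset_inter_le (v : V) (d : ℝ) :
    d * #{u ∈ G.neighborFinset v | d < #(G.neighborFinset v ∩ G.neighborFinset u)} ≤
      2 * (G.induce (G.neighborSet v)).edgeSet.ncard := by
  calc _ = ∑ u ∈ G.neighborFinset v with d < #(G.neighborFinset v ∩ G.neighborFinset u), d := by
        rw [sum_const, nsmul_eq_mul, mul_comm]
    _ ≤ ∑ u ∈ G.neighborFinset v with d < #(G.neighborFinset v ∩ G.neighborFinset u),
          (#(G.neighborFinset v ∩ G.neighborFinset u) : ℝ) :=
        sum_le_sum fun u hu => (mem_filter.1 hu).2.le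
    _ ≤ ∑ u ∈ G.neighborFinset v, (#(G.neighborFinset v ∩ G.neighborFinset u) : ℝ) :=
        sum_le_sum_of_subset_of_nonneg (filter_subset _ _) fun _ _ _ => Nat.cast_nonneg _
    _ = _ := by exact_mod_cast sum_card_neighborFinset_inter v

variable {α : Type*} [DecidableEq α] {L : V → Finset α}

variable (G L) in
/-- The neighbours of `v` in `S` that have at most `d` common neighbours with `v` and for which
the colouring `c` of the non-neighbours of `v` in `S` leaves more than `t` colours available. The
colours that `c` gives to the neighbours of `v` are irrelevant. -/
noncomputable def goodNeighbors (S : Finset V) (v : V) (d t : ℝ) (c : V → α) : Finset V :=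
  {u ∈ S ∩ G.neighborFinset v | (#(G.neighborFinset v ∩ G.neighborFinset u) : ℝ) ≤ d ∧
    t < #(availableColors G L (S \ G.neighborFinset v) c u)}

variable {S : Finset V} {v : V} {d t l b n β Δ E : ℝ} {c₀ : V → α}

theorem goodNeighbors_subset (c : V → α) :
    goodNeighbors G L S v d t c ⊆ S ∩ G.neighborFinset v :=
  filter_subset _ _

theorem sdiff_neighborFinset_subset_sdiff_goodNeighbors (c : V → α) :
    S \ G.neighborFinset v ⊆ S \ goodNeighbors G L S v d t c :=
  sdiff_subset_sdiff Subset.rfl ((goodNeighbors_subset c).trans inter_subset_right)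

theorem goodNeighbors_congr {c c' : V → α} (h : ∀ u ∈ S \ G.neighborFinset v, c u = c' u) :
    goodNeighbors G L S v d t c = goodNeighbors G L S v d t c' := by
  simp only [goodNeighbors, availableColors_congr h]

theorem piecewise_sdiff_goodNeighbors_eq_iff {c bg : V → α} :
    (S \ goodNeighbors G L S v d t c).piecewise c bg =
        (S \ goodNeighbors G L S v d t c₀).piecewise c₀ bg ↔
      ∀ u ∈ S \ goodNeighbors G L S v d t c₀, c u = c₀ u := by
  constructor
  · intro h
    have hgood : goodNeighbors G L S v d t c = goodNeighbors G L S v d t c₀ :=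
      goodNeighbors_congr fun u hu => by
        have hu' := fun c => sdiff_neighborFinset_subset_sdiff_goodNeighbors
          (G := G) (L := L) (d := d) (t := t) c hu
        simpa only [piecewise_eq_of_mem _ _ _ (hu' _)] using congrFun h u
    intro u hu
    simpa only [hgood, piecewise_eq_of_mem _ _ _ hu] using congrFun h u
  · intro h
    rw [goodNeighbors_congr fun u hu =>
      h u (sdiff_neighborFinset_subset_sdiff_goodNeighbors c₀ hu)]
    exact piecewise_congr _ h fun _ _ => rfl

theorem lt_card_availableColors_sdiff_goodNeighbors {u : V}
    (hu : u ∈ goodNeighbors G L S v d t c₀) :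
    t - d < #(availableColors G L (S \ goodNeighbors G L S v d t c₀) c₀ u) := by
  obtain ⟨-, hcommon, havail⟩ := mem_filter.1 hu
  have hle := card_availableColors_le_add (G := G) (L := L) (S \ G.neighborFinset v)
    (S \ goodNeighbors G L S v d t c₀) c₀ u
  have hlost : #{w ∈ (S \ goodNeighbors G L S v d t c₀) \ (S \ G.neighborFinset v) | G.Adj u w} ≤
      #(G.neighborFinset v ∩ G.neighborFinset u) := by
    refine card_le_card fun w hw => ?_
    simp only [mem_filter, mem_sdiff, mem_inter, SimpleGraph.mem_neighborFinset] at hw ⊢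
    tauto
  have : (#(availableColors G L (S \ G.neighborFinset v) c₀ u) : ℝ) ≤
      #(availableColors G L (S \ goodNeighbors G L S v d t c₀) c₀ u) +
        #(G.neighborFinset v ∩ G.neighborFinset u) := by
    exact_mod_cast hle.trans (Nat.add_le_add_left hlost _)
  linarith

theorem le_card_availableColors_sdiff_goodNeighbors
    (hbad : (#((S ∩ G.neighborFinset v) \ goodNeighbors G L S v d t c₀) : ℝ) ≤ b)
    (hn : n + b ≤ #(L v)) :
    n ≤ #(availableColors G L (S \ goodNeighbors G L S v d t c₀) c₀ v) := by
  have hle := card_le_card_availableColors_add (G := G) (L := L)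
    (S \ goodNeighbors G L S v d t c₀) c₀ v
  have heq : {u ∈ S \ goodNeighbors G L S v d t c₀ | G.Adj v u} =
      (S ∩ G.neighborFinset v) \ goodNeighbors G L S v d t c₀ := by
    ext u
    simp only [mem_filter, mem_sdiff, mem_inter, SimpleGraph.mem_neighborFinset]
    tauto
  rw [heq, ← Nat.cast_le (α := ℝ), Nat.cast_add] at hle
  linarith

theorem mul_exp_mul_card_extensions_le_sum_card_availableColors {bg : V → α}
    (hc₀ : c₀ ∈ coloringsOn G L S bg) (hβ : 1 < β) (hd : 0 ≤ d)
    (ht : β * (d + 1) ≤ (β - 1) * (t - d)) (hn : 0 < n) (hL : n + b ≤ #(L v))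
    (hdeg : (G.degree v : ℝ) ≤ Δ)
    (hbad : (#((S ∩ G.neighborFinset v) \ goodNeighbors G L S v d t c₀) : ℝ) ≤ b) :
    n * Real.exp (-(β * Δ / n)) *
        #{c ∈ coloringsOn G L S bg | ∀ u ∈ S \ goodNeighbors G L S v d t c₀, c u = c₀ u} ≤
      ∑ c ∈ coloringsOn G L S bg with ∀ u ∈ S \ goodNeighbors G L S v d t c₀, c u = c₀ u,
        (#(availableColors G L S c v) : ℝ) := by
  have hgoodS : S \ (S \ goodNeighbors G L S v d t c₀) = goodNeighbors G L S v d t c₀ :=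
    Finset.sdiff_sdiff_eq_self ((goodNeighbors_subset c₀).trans inter_subset_left)
  have hsub := (goodNeighbors_subset (G := G) (L := L) (S := S) (v := v) (d := d) (t := t)
    c₀).trans inter_subset_right
  have hcard : (#(goodNeighbors G L S v d t c₀) : ℝ) ≤ Δ :=
    (Nat.cast_le.2 (card_le_card hsub)).trans hdeg
  have hX := le_card_availableColors_sdiff_goodNeighbors hbad hL
  have hdegGood : ∀ u ∈ goodNeighbors G L S v d t c₀,
      (#{w ∈ goodNeighbors G L S v d t c₀ | G.Adj u w} : ℝ) ≤ d := fun u hu => by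
    refine le_trans (Nat.cast_le.2 (card_le_card fun w hw => ?_)) (mem_filter.1 hu).2.1
    rw [mem_filter] at hw
    exact mem_inter.2 ⟨hsub hw.1, (G.mem_neighborFinset u w).2 hw.2⟩
  have h := card_mul_exp_mul_card_extensions_le_sum_card_availableColors
    (T := S \ goodNeighbors G L S v d t c₀) sdiff_subset hc₀ hβ hd (by rwa [hgoodS])
    (fun u hu => by
      rw [hgoodS] at hu
      have := lt_card_availableColors_sdiff_goodNeighbors hu
      exact ht.trans (by gcongr)) v
  rw [hgoodS] at h
  refine le_trans ?_ h
  have hΔ : 0 ≤ β * Δ := mul_nonneg (by linarith) ((Nat.cast_nonneg _).trans hdeg)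
  gcongr

theorem filter_piecewise_eq_filter_forall_eq {bg : V → α} {C : Finset (V → α)}
    (hbad : (#((S ∩ G.neighborFinset v) \ goodNeighbors G L S v d t c₀) : ℝ) ≤ b) :
    {c ∈ {c ∈ C | (#((S ∩ G.neighborFinset v) \ goodNeighbors G L S v d t c) : ℝ) ≤ b} |
      (S \ goodNeighbors G L S v d t c).piecewise c bg =
        (S \ goodNeighbors G L S v d t c₀).piecewise c₀ bg} =
      {c ∈ C | ∀ u ∈ S \ goodNeighbors G L S v d t c₀, c u = c₀ u} := by
  simp only [piecewise_sdiff_goodNeighbors_eq_iff, filter_filter]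
  refine filter_congr fun c _ => and_iff_right_of_imp fun h => ?_
  rwa [goodNeighbors_congr fun u hu =>
    h u (sdiff_neighborFinset_subset_sdiff_goodNeighbors c₀ hu)]

theorem mul_exp_mul_card_filter_le_sum_card_availableColors {bg : V → α} (hβ : 1 < β) (hd : 0 ≤ d)
    (ht : β * (d + 1) ≤ (β - 1) * (t - d)) (hn : 0 < n) (hL : n + b ≤ #(L v))
    (hdeg : (G.degree v : ℝ) ≤ Δ) :
    n * Real.exp (-(β * Δ / n)) * #{c ∈ coloringsOn G L S bg |
        (#((S ∩ G.neighborFinset v) \ goodNeighbors G L S v d t c) : ℝ) ≤ b} ≤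
      ∑ c ∈ coloringsOn G L S bg, (#(availableColors G L S c v) : ℝ) := by
  refine le_trans ?_ (sum_le_sum_of_subset_of_nonneg (filter_subset
    (fun c => (#((S ∩ G.neighborFinset v) \ goodNeighbors G L S v d t c) : ℝ) ≤ b) _)
    fun _ _ _ => Nat.cast_nonneg _)
  rw [mul_comm, ← nsmul_eq_mul, ← sum_const]
  refine sum_le_sum_of_forall_fiber
    (fun c => (S \ goodNeighbors G L S v d t c).piecewise c bg) fun c₀ hc₀ => ?_
  obtain ⟨hc₀, hbad⟩ := mem_filter.1 hc₀
  rw [filter_piecewise_eq_filter_forall_eq hbad, sum_const, nsmul_eq_mul, mul_comm]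
  exact mul_exp_mul_card_extensions_le_sum_card_availableColors hc₀ hβ hd ht hn hL hdeg hbad

/-- A colouring counted on the left extends one of the at most `#(coloringsOn G L S bg) / l`
colourings of `S.erase u`, each of which has at most `t` such extensions. -/
theorem card_filter_card_availableColors_sdiff_le {bg : V → α} (ht : 0 ≤ t) (hl : 0 < l) {u : V}
    (hu : u ∈ S ∩ G.neighborFinset v)
    (hgrowth : l * #(coloringsOn G L (S.erase u) bg) ≤ #(coloringsOn G L S bg)) :
    (#{c ∈ coloringsOn G L S bg |
        (#(availableColors G L (S \ G.neighborFinset v) c u) : ℝ) ≤ t} : ℝ) ≤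
      t / l * #(coloringsOn G L S bg) := by
  obtain ⟨huS, huv⟩ := mem_inter.1 hu
  have hsub : S \ G.neighborFinset v ⊆ S.erase u := fun w hw =>
    mem_erase.2 ⟨fun h => (mem_sdiff.1 hw).2 (h ▸ huv), (mem_sdiff.1 hw).1⟩
  have hexpose := card_filter_card_availableColors_le (G := G) (L := L) (b := bg)
    (notMem_erase u S) ht
  rw [insert_erase huS] at hexpose
  calc _ ≤ (#{c ∈ coloringsOn G L S bg |
          (#(availableColors G L (S.erase u) c u) : ℝ) ≤ t} : ℝ) :=
        Nat.cast_le.2 <| card_le_card <| monotone_filter_right _ fun c _ hc =>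
          (Nat.cast_le.2 (card_le_card (availableColors_anti hsub c u))).trans hc
    _ ≤ t * #(coloringsOn G L (S.erase u) bg) := hexpose
    _ ≤ t * (#(coloringsOn G L S bg) / l) := by
        gcongr
        rwa [le_div_iff₀' hl]
    _ = t / l * #(coloringsOn G L S bg) := by ring

theorem card_sdiff_goodNeighbors_le (c : V → α) :
    #((S ∩ G.neighborFinset v) \ goodNeighbors G L S v d t c) ≤
      #{u ∈ G.neighborFinset v | d < #(G.neighborFinset v ∩ G.neighborFinset u)} +
        #{u ∈ S ∩ G.neighborFinset v |
          (#(availableColors G L (S \ G.neighborFinset v) c u) : ℝ) ≤ t} := by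
  refine (card_le_card fun u hu => ?_).trans (card_union_le _ _)
  rw [mem_sdiff, goodNeighbors, mem_filter] at hu
  simp only [mem_union, mem_filter]
  have huv := inter_subset_right hu.1
  grind

theorem sum_card_sdiff_goodNeighbors_le {bg : V → α} (hd : 0 < d) (ht : 0 ≤ t) (hl : 0 < l)
    (hdeg : (G.degree v : ℝ) ≤ Δ) (hE : ((G.induce (G.neighborSet v)).edgeSet.ncard : ℝ) ≤ E)
    (hgrowth : ∀ u ∈ S, l * #(coloringsOn G L (S.erase u) bg) ≤ #(coloringsOn G L S bg)) :
    ∑ c ∈ coloringsOn G L S bg,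
        (#((S ∩ G.neighborFinset v) \ goodNeighbors G L S v d t c) : ℝ) ≤
      (2 * E / d + Δ * (t / l)) * #(coloringsOn G L S bg) := by
  have hhigh : (#{u ∈ G.neighborFinset v | d < #(G.neighborFinset v ∩ G.neighborFinset u)} : ℝ) ≤
      2 * E / d := by
    rw [le_div_iff₀' hd]
    linarith [mul_card_filter_lt_card_neighborFinset_inter_le (G := G) v d]
  have hcard : (#(S ∩ G.neighborFinset v) : ℝ) ≤ Δ :=
    (Nat.cast_le.2 (card_le_card inter_subset_right)).trans hdeg
  calc _ ≤ ∑ c ∈ coloringsOn G L S bg,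
        ((#{u ∈ G.neighborFinset v | d < #(G.neighborFinset v ∩ G.neighborFinset u)} : ℝ) +
          #{u ∈ S ∩ G.neighborFinset v |
            (#(availableColors G L (S \ G.neighborFinset v) c u) : ℝ) ≤ t}) :=
        sum_le_sum fun c _ => by exact_mod_cast card_sdiff_goodNeighbors_le c
    _ = #(coloringsOn G L S bg) *
          #{u ∈ G.neighborFinset v | d < #(G.neighborFinset v ∩ G.neighborFinset u)} +
        ∑ u ∈ S ∩ G.neighborFinset v, (#{c ∈ coloringsOn G L S bg |
          (#(availableColors G L (S \ G.neighborFinset v) c u) : ℝ) ≤ t} : ℝ) := by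
        rw [sum_add_distrib, sum_const, nsmul_eq_mul]
        congr 1
        simp only [card_filter, Nat.cast_sum]
        exact sum_comm
    _ ≤ #(coloringsOn G L S bg) * (2 * E / d) +
        ∑ _u ∈ S ∩ G.neighborFinset v, t / l * #(coloringsOn G L S bg) := by
        gcongr with u hu
        exact card_filter_card_availableColors_sdiff_le ht hl hu
          (hgrowth u (inter_subset_left hu))
    _ = (2 * E / d + #(S ∩ G.neighborFinset v) * (t / l)) * #(coloringsOn G L S bg) := by
        rw [sum_const, nsmul_eq_mul]
        ring
    _ ≤ _ := by gcongr

theorem pos_of_two_mul_le_mul_exp {x : ℝ} (hl : 0 < l) (h : 2 * l ≤ n * Real.exp x) : 0 < n :=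
  (pos_iff_pos_of_mul_pos ((mul_pos two_pos hl).trans_le h)).2 (Real.exp_pos x)

theorem mul_card_coloringsOn_le_insert {bg : V → α} (hv : v ∉ S) (hd : 0 < d) (hl : 0 < l)
    (hβ : 1 < β) (ht : β * (d + 1) ≤ (β - 1) * (t - d)) (hb : 0 < b)
    (hbad : 2 * E / d + Δ * (t / l) ≤ b / 2) (hL : n + b ≤ #(L v))
    (hln : 2 * l ≤ n * Real.exp (-(β * Δ / n))) (hdeg : (G.degree v : ℝ) ≤ Δ)
    (hE : ((G.induce (G.neighborSet v)).edgeSet.ncard : ℝ) ≤ E)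
    (hgrowth : ∀ u ∈ S, l * #(coloringsOn G L (S.erase u) bg) ≤ #(coloringsOn G L S bg)) :
    l * #(coloringsOn G L S bg) ≤ #(coloringsOn G L (insert v S) bg) := by
  have ht0 : 0 ≤ t := by nlinarith
  have hn := pos_of_two_mul_le_mul_exp hl hln
  have hmean := (sum_card_sdiff_goodNeighbors_le hd ht0 hl hdeg hE hgrowth).trans
    (mul_le_mul_of_nonneg_right hbad (Nat.cast_nonneg _))
  have hhalf := card_le_two_mul_card_filter_of_sum_le (fun _ _ => Nat.cast_nonneg _) hb hmean
  rw [card_coloringsOn_insert hv, Nat.cast_sum]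
  calc _ ≤ l * (2 * #{c ∈ coloringsOn G L S bg |
          (#((S ∩ G.neighborFinset v) \ goodNeighbors G L S v d t c) : ℝ) ≤ b}) := by gcongr
    _ = 2 * l * #{c ∈ coloringsOn G L S bg |
          (#((S ∩ G.neighborFinset v) \ goodNeighbors G L S v d t c) : ℝ) ≤ b} := by ring
    _ ≤ n * Real.exp (-(β * Δ / n)) * #{c ∈ coloringsOn G L S bg |
          (#((S ∩ G.neighborFinset v) \ goodNeighbors G L S v d t c) : ℝ) ≤ b} := by gcongr
    _ ≤ _ := mul_exp_mul_card_filter_le_sum_card_availableColors hβ hd.le ht hn hL hdeg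

theorem pow_card_le_card_coloringsOn {bg : V → α} (hl : 0 ≤ l)
    (hstep : ∀ (S : Finset V), ∀ v ∉ S,
      (∀ u ∈ S, l * #(coloringsOn G L (S.erase u) bg) ≤ #(coloringsOn G L S bg)) →
      l * #(coloringsOn G L S bg) ≤ #(coloringsOn G L (insert v S) bg)) (S : Finset V) :
    l ^ #S ≤ #(coloringsOn G L S bg) := by
  have hgrowth : ∀ S : Finset V, ∀ v ∉ S,
      l * #(coloringsOn G L S bg) ≤ #(coloringsOn G L (insert v S) bg) := by
    intro S
    induction S using Finset.strongInduction with
    | H S ih =>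
      refine fun v hv => hstep S v hv fun u hu => ?_
      simpa only [insert_erase hu] using ih (S.erase u) (erase_ssubset hu) u (notMem_erase u S)
  induction S using Finset.induction_on with
  | empty => simp [coloringsOn_empty]
  | insert v S hv ih =>
    rw [card_insert_of_notMem hv, pow_succ']
    exact (mul_le_mul_of_nonneg_left ih hl).trans (hgrowth S v hv)

end Extension

theorem exists_coloring_of_sparse_neighborhoods {V α : Type*} [Fintype V] {G : SimpleGraph V}
    [DecidableRel G.Adj] {L : V → Finset α} {d t l b n β Δ E : ℝ} (hd : 0 < d) (hl : 0 < l)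
    (hβ : 1 < β) (ht : β * (d + 1) ≤ (β - 1) * (t - d)) (hb : 0 < b)
    (hbad : 2 * E / d + Δ * (t / l) ≤ b / 2) (hL : ∀ v, n + b ≤ #(L v))
    (hln : 2 * l ≤ n * Real.exp (-(β * Δ / n))) (hdeg : ∀ v, (G.degree v : ℝ) ≤ Δ)
    (hE : ∀ v, ((G.induce (G.neighborSet v)).edgeSet.ncard : ℝ) ≤ E) :
    ∃ c : V → α, (∀ v, c v ∈ L v) ∧ ∀ u v, G.Adj u v → c u ≠ c v := by
  classical
  have hne : ∀ v, (L v).Nonempty := fun v =>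
    card_pos.1 (Nat.cast_pos.1 ((add_pos (pos_of_two_mul_le_mul_exp hl hln) hb).trans_le (hL v)))
  choose bg _ using hne
  have hpow := pow_card_le_card_coloringsOn (G := G) (L := L) (bg := bg) hl.le (fun S v hv =>
    mul_card_coloringsOn_le_insert hv hd hl hβ ht hb hbad (hL v) hln (hdeg v) (hE v)) univ
  obtain ⟨c, hc⟩ := card_pos.1 (Nat.cast_pos.1 ((pow_pos hl _).trans_le hpow))
  rw [mem_coloringsOn] at hc
  exact ⟨c, fun v => hc.1 v (mem_univ v), fun u v => hc.2.2 u (mem_univ u) v (mem_univ v)⟩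

section Parameters

theorem rpow_div_self_le_exp {F δ Δ : ℝ} (hF : 1 < F) (hδ : 0 < δ) (hδ1 : δ ≤ 1 / 8)
    (hΔ : 0 < Δ) :
    F ^ (2 * δ) / F ≤ Real.exp (-((1 + δ) * Δ / ((1 + 4 * δ) * (Δ / Real.log F)))) := by
  have hlog : 0 < Real.log F := Real.log_pos hF
  have hratio : (1 + δ) / (1 + 4 * δ) ≤ 1 - 2 * δ := by
    rw [div_le_iff₀ (by linarith)]
    nlinarith
  have hexponent : (1 + δ) * Δ / ((1 + 4 * δ) * (Δ / Real.log F)) =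
      (1 + δ) / (1 + 4 * δ) * Real.log F := by
    field_simp
  rw [hexponent, ← Real.rpow_sub_one (by linarith), Real.rpow_def_of_pos (by linarith),
    Real.exp_le_exp]
  nlinarith

theorem five_mul_le_mul_of_mul_log_pow_le {F δ Δ : ℝ} (hF : 1 < F) (hδ : 0 < δ) (hΔ : 0 < Δ)
    (hpow : 320 * Real.log F ^ 3 ≤ δ ^ 3 * F ^ (2 * δ)) :
    5 * (8 * Δ * Real.log F / (δ * F)) ≤
      δ * (δ * (Δ * F ^ (2 * δ) / (2 * Real.log F * F)) / (4 * Real.log F)) := by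
  have hlog : 0 < Real.log F := Real.log_pos hF
  calc _ = Δ / (8 * δ * F * Real.log F ^ 2) * (320 * Real.log F ^ 3) := by
        field_simp
        norm_num
    _ ≤ Δ / (8 * δ * F * Real.log F ^ 2) * (δ ^ 3 * F ^ (2 * δ)) := by gcongr
    _ = _ := by
        field_simp
        norm_num

theorem exists_coloring_of_card_edgeSet_le {V α : Type*} [Fintype V] {G : SimpleGraph V}
    [DecidableRel G.Adj] {L : V → Finset α} {δ F Δ : ℝ}
    (hδ : 0 < δ) (hδ1 : δ ≤ 1 / 8) (hF : 1 < F) (hFΔ : F ≤ Δ) (hlog : 1 ≤ Real.log F)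
    (hpow : 320 * Real.log F ^ 3 ≤ δ ^ 3 * F ^ (2 * δ)) (hdeg : ∀ v, (G.degree v : ℝ) ≤ Δ)
    (hedge : ∀ v, ((G.induce (G.neighborSet v)).edgeSet.ncard : ℝ) ≤ Δ ^ 2 / F)
    (hL : ∀ v, (1 + 5 * δ) * (Δ / Real.log F) ≤ #(L v)) :
    ∃ c : V → α, (∀ v, c v ∈ L v) ∧ ∀ u v, G.Adj u v → c u ≠ c v := by
  have : 0 < F := by linarith
  have hΔ0 : 0 < Δ := by linarith
  have hpow' := five_mul_le_mul_of_mul_log_pow_le hF hδ hΔ0 hpow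
  set d := 8 * Δ * Real.log F / (δ * F) with hd
  set l := Δ * F ^ (2 * δ) / (2 * Real.log F * F) with hl
  set t := δ * l / (4 * Real.log F) with ht
  have hd1 : 1 ≤ d := by
    rw [hd, le_div_iff₀ (by positivity)]
    nlinarith [mul_le_mul hFΔ hlog zero_le_one hΔ0.le]
  refine exists_coloring_of_sparse_neighborhoods (d := d) (l := l) (t := t) (β := 1 + δ)
    (b := δ * (Δ / Real.log F)) (n := (1 + 4 * δ) * (Δ / Real.log F)) (by positivity)
    (by positivity) (by linarith) (by nlinarith) (by positivity) ?_
    (fun v => (hL v).trans_eq' (by ring)) ?_ hdeg hedge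
  · have hcommon : 2 * (Δ ^ 2 / F) / d = δ * (Δ / Real.log F) / 4 := by
      rw [hd]
      field_simp
      norm_num
    have havail : Δ * (t / l) = δ * (Δ / Real.log F) / 4 := by
      rw [ht, hl]
      field_simp
    linarith
  · calc 2 * l = 1 * (Δ / Real.log F) * (F ^ (2 * δ) / F) := by
          rw [hl]
          field_simp
      _ ≤ (1 + 4 * δ) * (Δ / Real.log F) *
          Real.exp (-((1 + δ) * Δ / ((1 + 4 * δ) * (Δ / Real.log F)))) := by
          gcongr
          · linarith
          · exact rpow_div_self_le_exp hF hδ hδ1 hΔ0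

theorem eventually_log_bounds {δ : ℝ} (hδ : 0 < δ) : ∀ᶠ F : ℝ in Filter.atTop,
    1 ≤ Real.log F ∧ 320 * Real.log F ^ 3 ≤ δ ^ 3 * F ^ (2 * δ) ∧ Real.log F ≤ δ * F := by
  have hpow := (isLittleO_log_rpow_rpow_atTop (3 : ℕ) (by linarith : 0 < 2 * δ)).def
    (show 0 < δ ^ 3 / 320 by positivity)
  have hlin := Real.isLittleO_log_id_atTop.def hδ
  filter_upwards [Real.tendsto_log_atTop.eventually_ge_atTop 1, hpow, hlin,
    Filter.eventually_gt_atTop 0] with F hlog hpow hlin hF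
  refine ⟨hlog, ?_, ?_⟩
  · rw [Real.rpow_natCast, Real.norm_of_nonneg (by positivity),
      Real.norm_of_nonneg (by positivity)] at hpow
    linarith
  · rwa [Real.norm_of_nonneg (by positivity), id, Real.norm_of_nonneg hF.le] at hlin

theorem isChoosable_of_forall_finset {V : Type*} {G : SimpleGraph V} {k : ℕ}
    (h : ∀ L : V → Finset ℕ, (∀ v, #(L v) = k) →
      ∃ c : V → ℕ, (∀ v, c v ∈ L v) ∧ ∀ u v, G.Adj u v → c u ≠ c v) : G.IsChoosable k := by
  intro L hL
  choose M hM hMk using fun v => Set.exists_subset_encard_eq (hL v)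
  have hfin : ∀ v, (M v).Finite := fun v => Set.finite_of_encard_eq_coe (hMk v)
  obtain ⟨c, hc, hprop⟩ := h (fun v => (hfin v).toFinset) fun v => by
    have hcard := (hfin v).encard_eq_coe_toFinset_card
    rw [hMk v] at hcard
    exact_mod_cast hcard.symm
  exact ⟨c, fun v => hM v ((hfin v).mem_toFinset.1 (hc v)), hprop⟩

theorem exists_listChromaticNumber_eq_of_isChoosable {V : Type*} {G : SimpleGraph V} {k : ℕ}
    (h : G.IsChoosable k) : ∃ n : ℕ, G.listChromaticNumber = n ∧ n ≤ k := by
  have hle : G.listChromaticNumber ≤ k := iInf₂_le k h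
  obtain ⟨n, hn⟩ := ENat.ne_top_iff_exists.1 (ne_top_of_le_ne_top (ENat.natCast_ne_top k) hle)
  exact ⟨n, hn.symm, by rw [← hn] at hle; exact_mod_cast hle⟩

theorem exists_forall_isChoosable_of_card_edgeSet_le {ε : ℝ} (hε : 0 < ε) :
    ∃ F₀ > 1, ∀ F Δ : ℝ, F₀ ≤ F → F ≤ Δ →
      ∀ {V : Type*} [Fintype V] {G : SimpleGraph V} [DecidableRel G.Adj],
        (∀ v, (G.degree v : ℝ) ≤ Δ) →
        (∀ v, ((G.induce (G.neighborSet v)).edgeSet.ncard : ℝ) ≤ Δ ^ 2 / F) →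
        G.IsChoosable ⌊(1 + ε) * (Δ / Real.log F)⌋₊ := by
  obtain ⟨δ, hδ, hδ1, hδε⟩ : ∃ δ > 0, δ ≤ 1 / 8 ∧ 6 * δ ≤ ε :=
    ⟨min ε 1 / 8, by positivity, by linarith [min_le_right ε 1],
      by linarith [min_le_left ε 1, lt_min hε one_pos]⟩
  obtain ⟨F₀, hF₀, hbounds⟩ := (Filter.eventually_atTop.1
    ((eventually_log_bounds hδ).and (Filter.eventually_gt_atTop 1))).imp
    fun a h => And.intro (h a le_rfl).2 h
  refine ⟨F₀, hF₀, fun F Δ hF hFΔ V _ G _ hdeg hedge => ?_⟩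
  obtain ⟨⟨hlog, hpow, hlin⟩, hF1⟩ := hbounds F hF
  have hround : (1 + 5 * δ) * (Δ / Real.log F) ≤ ⌊(1 + ε) * (Δ / Real.log F)⌋₊ := by
    have hone : 1 ≤ δ * (Δ / Real.log F) := by
      rw [mul_div_assoc', le_div_iff₀ (by linarith), one_mul]
      exact hlin.trans (by gcongr)
    have hfloor := Nat.lt_floor_add_one ((1 + ε) * (Δ / Real.log F))
    have hΔ : 0 ≤ Δ / Real.log F := div_nonneg (by linarith) (by linarith)
    linarith [mul_le_mul_of_nonneg_right hδε hΔ]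
  exact isChoosable_of_forall_finset fun L hL => exists_coloring_of_card_edgeSet_le hδ hδ1 hF1 hFΔ
    hlog hpow hdeg hedge fun v => by rwa [hL v]

end Parameters

end ListColoring

theorem mainTheorem7 (ε : ℝ) (hε : 0 < ε) :
    ∃ f₀ : ℝ, ∀ (V : Type*) [Fintype V] (G : SimpleGraph V) [DecidableRel G.Adj] (f : ℝ),
      f₀ ≤ f → 1 ≤ f → f ≤ (G.maxDegree : ℝ) ^ 2 + 1 →
      (∀ v : V, ((G.induce (G.neighborSet v)).edgeSet.ncard : ℝ) ≤ (G.maxDegree : ℝ) ^ 2 / f) →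
      ∃ k : ℕ, G.listChromaticNumber = k ∧
        (k : ℝ) ≤ (1 + ε) * ((G.maxDegree : ℝ) / Real.log (min (G.maxDegree : ℝ) f)) := by
  obtain ⟨F₀, hF₀, hchoosable⟩ := ListColoring.exists_forall_isChoosable_of_card_edgeSet_le hε
  refine ⟨F₀ ^ 2 + 1, fun V _ G _ f hf _ hfΔ hedge => ?_⟩
  have hΔ : F₀ ≤ G.maxDegree :=
    (pow_le_pow_iff_left₀ (by linarith) (Nat.cast_nonneg _) two_ne_zero).1 (by linarith)
  have hF : F₀ ≤ min (G.maxDegree : ℝ) f := le_min hΔ (by nlinarith)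
  obtain ⟨k, hk, hkfloor⟩ := ListColoring.exists_listChromaticNumber_eq_of_isChoosable <|
    hchoosable _ _ hF (min_le_left _ _) (fun v => Nat.cast_le.2 (G.degree_le_maxDegree v))
      fun v => (hedge v).trans (by gcongr; exacts [by linarith, min_le_right _ _])
  have hlog : 0 < Real.log (min (G.maxDegree : ℝ) f) := Real.log_pos (lt_of_lt_of_le hF₀ hF)
  exact ⟨k, hk, (Nat.cast_le.2 hkfloor).trans (Nat.floor_le (by positivity))⟩
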